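/- Let $\mathbb{H}$ be the real quaternions, with units $i,j,k$, and for a quaternion matrix $Q$ let $Q^H$ be its conjugate transpose. Write $Q\in\mathbb{H}^{M\times N}$ as $Q=Q_a+Q_b\,j$ with $Q_a=Q_0+Q_1 i$ and $Q_b=Q_2+Q_3 i$ complex matrices, where $Q=Q_0+Q_1i+Q_2j+Q_3k$ with real $Q_l$. The singular values of the complex matrix $$Q_c=\begin{pmatrix}Q_a&Q_b\\-\overline{Q_b}&\overline{Q_a}\end{pmatrix}\in\mathbb{C}^{2M\times 2N}$$ occur in equal pairs; if they are listed in decreasing order as $s_1\ge s_2\ge\cdots$, the singular values of $Q$ are $\sigma_k(Q)=s_{2k-1}$ for $1\le k\le\min(M,N)$. (These are the diagonal entries $\sigma_1\ge\sigma_2\ge\cdots\ge0$ of the real diagonal factor $D$ in a singular value decomposition $Q=ADB^H$ with $A,B$ unitary quaternion matrices.) For $0<p<\infty$ put $$\|Q\|_{Q\text{-}S_p}=\Bigl(\sum_{k=1}^{\min(M,N)}\sigma_k(Q)^p\Bigr)^{1/p},\qquad \|Q\|_*=\|Q\|_{Q\text{-}S_1}.$$ The rank of $Q$ is the maximal number of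 its right linearly independent columns. Theorem. Let $X\in\mathbb{H}^{M\times N}$ have $\operatorname{rank}(X)\le d$. Then the quaternion double nuclear norm $$\|X\|_{\mathrm{Q\text{-}DNN}}=\min\Bigl\{\tfrac14\bigl(\|U\|_*+\|V\|_*\bigr)^2 \;:\; U\in\mathbb{H}^{M\times d},\ V\in\mathbb{H}^{N\times d},\ X=UV^H\Bigr\}$$ is well defined (the minimum is attained), and $$\|X\|_{\mathrm{Q\text{-}DNN}}=\|X\|_{Q\text{-}S_{1/2}}.$$ -/

import Mathlib

open scoped Matrix Quaternion

namespace QuaternionMatrix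

noncomputable section

/-- The equivalent complex matrix of a quaternion matrix `Q = Qa + Qb j`, where
`Qa = Q₀ + Q₁ i` and `Qb = Q₂ + Q₃ i` are complex: the block matrix
`[[Qa, Qb], [-conj Qb, conj Qa]]`. -/
def complexAdjoint {M N : ℕ} (Q : Matrix (Fin M) (Fin N) ℍ) :
    Matrix (Fin M ⊕ Fin M) (Fin N ⊕ Fin N) ℂ :=
  Matrix.fromBlocks
    (Q.map fun q => (⟨q.re, q.imI⟩ : ℂ))
    (Q.map fun q => (⟨q.imJ, q.imK⟩ : ℂ))
    (Q.map fun q => -star (⟨q.imJ, q.imK⟩ : ℂ))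
    (Q.map fun q => star (⟨q.re, q.imI⟩ : ℂ))

/-- The `k`-th singular value (counted from `0`, in decreasing order, with multiplicity) of a
quaternion matrix. The decreasingly ordered singular values of the equivalent complex matrix are
those of `Q`, each repeated twice, so one takes every other one of them, starting with the
largest. -/
def singularValue {M N : ℕ} (Q : Matrix (Fin M) (Fin N) ℍ) (k : ℕ) : ℝ :=
  (Matrix.toEuclideanLin (complexAdjoint Q)).singularValues (2 * k)

/-- The rank of a quaternion matrix: the dimension of the right `ℍ`-vector space spanned by its
columns, that is, the maximal number of right linearly independent columns. -/
def rank {M N : ℕ} (Q : Matrix (Fin M) (Fin N) ℍ) : ℕ :=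
  Module.finrank ℍᵐᵒᵖ (Submodule.span ℍᵐᵒᵖ (Set.range Q.col))

/-- The Q-Schatten-`p` (quasi-)norm of a quaternion matrix, for `0 < p < ∞`. -/
def schatten {M N : ℕ} (p : ℝ) (Q : Matrix (Fin M) (Fin N) ℍ) : ℝ :=
  (∑ k ∈ Finset.range (min M N), singularValue Q k ^ p) ^ (1 / p)

/-- The quaternion nuclear norm: the Q-Schatten-`1` norm. -/
def nuclearNorm {M N : ℕ} (Q : Matrix (Fin M) (Fin N) ℍ) : ℝ :=
  schatten 1 Q

/-- The values `(1/4) (‖U‖_* + ‖V‖_*)²` over all factorizations `X = U Vᴴ` with `U` of size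
`M × d` and `V` of size `N × d`. -/
def doubleNuclearValues {M N : ℕ} (d : ℕ) (X : Matrix (Fin M) (Fin N) ℍ) : Set ℝ :=
  {t | ∃ (U : Matrix (Fin M) (Fin d) ℍ) (V : Matrix (Fin N) (Fin d) ℍ),
    X = U * Vᴴ ∧ t = 1 / 4 * (nuclearNorm U + nuclearNorm V) ^ 2}

/-- The quaternion double nuclear norm with inner dimension `d`. It is meant for matrices of rank
at most `d`; that the infimum is a minimum is part of the theorem. -/
def doubleNuclearNorm {M N : ℕ} (d : ℕ) (X : Matrix (Fin M) (Fin N) ℍ) : ℝ :=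
  sInf (doubleNuclearValues d X)

end

end QuaternionMatrix

/-! The map `complexAdjoint` is injective and respects products and conjugate transposes, so the
lower bound can be proved for complex operators. Let `T = A B*` have singular vectors `T bᵢ = σᵢ aᵢ`
with `σᵢ > 0`. Then `uᵢ = A* aᵢ` and `wᵢ = B* bᵢ` are biorthogonal with `⟪wᵢ, uᵢ⟫ = σᵢ`.
Gram–Schmidt on `u` gives an orthonormal `e` with `⟪eᵢ, uᵢ⟫ = l` and `⟪eᵢ, wᵢ⟫ = σᵢ / l` for some `l
> 0` depending on `i`, and AM–GM bounds their sum below by `2√σᵢ`. Summing over `i`, the trace-norm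
inequality `∑ Re ⟪A eᵢ, aᵢ⟫ ≤ ‖A‖_*`, applied also to `B`, gives `2 ∑ √σᵢ ≤ ‖A‖_* + ‖B‖_*`. No
Hölder inequality for Schatten quasi-norms is needed.

The bound returns to quaternions because complex singular values come in equal pairs, so both sides
double. Pairing follows from a quaternionic spectral theorem: the complex Gram matrix commutes with
an antiunitary `J`, `J² = -1`, so eigenvectors come as `v, J v`.

Equality holds for `U = A D^{1/2}`, `V = B D^{1/2}` built from a singular value decomposition `X = A
D Bᴴ`. The rank hypothesis makes inner dimension `d` sufficient. -/

/-! ### Trace-norm inequalities for operators on inner product spaces. -/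

/-- If `⟪uᵢ, wⱼ⟫ = σᵢ δᵢⱼ` with `σᵢ ≠ 0`, then `u` is linearly independent. -/
theorem LinearIndependent.of_inner_eq_ite {𝕜 E ι : Type*} [RCLike 𝕜]
    [NormedAddCommGroup E] [InnerProductSpace 𝕜 E] [Fintype ι] [DecidableEq ι]
    {u w : ι → E} {σ : ι → 𝕜} (hσ : ∀ i, σ i ≠ 0)
    (h : ∀ i j, inner 𝕜 (w j) (u i) = if i = j then σ i else 0) : LinearIndependent 𝕜 u := by
  rw [Fintype.linearIndependent_iff]
  intro c hc i
  have := congrArg (inner 𝕜 (w i)) hc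
  simpa [inner_sum, inner_smul_right, h, hσ i] using this

namespace LinearMap

open Module InnerProductSpace

variable {𝕜 : Type*} [RCLike 𝕜]
  {E : Type*} [NormedAddCommGroup E] [InnerProductSpace 𝕜 E] [FiniteDimensional 𝕜 E]
  {F : Type*} [NormedAddCommGroup F] [InnerProductSpace 𝕜 F] [FiniteDimensional 𝕜 F]
  {G : Type*} [NormedAddCommGroup G] [InnerProductSpace 𝕜 G] [FiniteDimensional 𝕜 G]

/-- The images of the right singular vectors of `T` are orthogonal, and their squared norms are
the squared singular values. -/
theorem inner_apply_eigenvectorBasis_adjoint_comp_self (T : E →ₗ[𝕜] F) {n : ℕ}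
    (hn : finrank 𝕜 E = n) (i j : Fin n) :
    inner 𝕜 (T (T.isSymmetric_adjoint_comp_self.eigenvectorBasis hn i))
        (T (T.isSymmetric_adjoint_comp_self.eigenvectorBasis hn j)) =
      if i = j then ((T.singularValues i : 𝕜)) ^ 2 else 0 := by
  set b := T.isSymmetric_adjoint_comp_self.eigenvectorBasis hn
  have h := T.isSymmetric_adjoint_comp_self.apply_eigenvectorBasis hn j
  rw [← LinearMap.adjoint_inner_right, ← LinearMap.comp_apply, h, inner_smul_right,
    b.inner_eq_ite, ← T.sq_singularValues_fin hn j]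
  by_cases hij : i = j <;> simp [hij]

theorem norm_apply_eigenvectorBasis_adjoint_comp_self (T : E →ₗ[𝕜] F) {n : ℕ}
    (hn : finrank 𝕜 E = n) (i : Fin n) :
    ‖T (T.isSymmetric_adjoint_comp_self.eigenvectorBasis hn i)‖ = T.singularValues i := by
  have h := T.inner_apply_eigenvectorBasis_adjoint_comp_self hn i i
  rw [if_pos rfl, inner_self_eq_norm_sq_to_K] at h
  have h' : ‖T (T.isSymmetric_adjoint_comp_self.eigenvectorBasis hn i)‖ ^ 2
      = T.singularValues i ^ 2 := by exact_mod_cast h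
  exact (sq_eq_sq₀ (norm_nonneg _) (T.singularValues_nonneg _)).1 h'

/-- For orthonormal families `e` and `a`, the real part of `∑ ⟪T eᵢ, aᵢ⟫` is at most the sum of the
singular values of `T`. -/
theorem sum_re_inner_le_sum_singularValues {ι : Type*} [Fintype ι] (T : E →ₗ[𝕜] F)
    {e : ι → E} {a : ι → F} (he : Orthonormal 𝕜 e) (ha : Orthonormal 𝕜 a) {n : ℕ}
    (hn : finrank 𝕜 E = n) :
    ∑ i, RCLike.re (inner 𝕜 (T (e i)) (a i)) ≤ ∑ k ∈ Finset.range n, T.singularValues k := by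
  set g := T.isSymmetric_adjoint_comp_self.eigenvectorBasis hn with hg
  have hexp (i : ι) : inner 𝕜 (T (e i)) (a i)
      = ∑ k, inner 𝕜 (e i) (g k) * inner 𝕜 (T (g k)) (a i) := by
    conv_lhs => rw [← g.sum_repr' (e i), map_sum, sum_inner]
    refine Finset.sum_congr rfl fun k _ => ?_
    rw [map_smul, inner_smul_left, inner_conj_symm]
  simp only [hexp, map_sum]
  rw [Finset.sum_comm, Finset.sum_range]
  refine Finset.sum_le_sum fun k _ => ?_
  -- For fixed `k`: Cauchy–Schwarz in `i`, then Bessel for `e` and for `a`.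
  calc ∑ i, RCLike.re (inner 𝕜 (e i) (g k) * inner 𝕜 (T (g k)) (a i))
      ≤ ∑ i, ‖inner 𝕜 (e i) (g k)‖ * ‖inner 𝕜 (a i) (T (g k))‖ :=
        Finset.sum_le_sum fun i _ => (RCLike.re_le_norm _).trans
          (by rw [norm_mul, norm_inner_symm (T (g k))])
    _ ≤ √(∑ i, ‖inner 𝕜 (e i) (g k)‖ ^ 2) * √(∑ i, ‖inner 𝕜 (a i) (T (g k))‖ ^ 2) :=
        Real.sum_mul_le_sqrt_mul_sqrt _ _ _
    _ ≤ √(‖g k‖ ^ 2) * √(‖T (g k)‖ ^ 2) := by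
        gcongr
        · exact he.sum_inner_products_le _
        · exact ha.sum_inner_products_le _
    _ = T.singularValues k := by
        rw [Real.sqrt_sq (norm_nonneg _), Real.sqrt_sq (norm_nonneg _), g.norm_eq_one, one_mul,
          hg, norm_apply_eigenvectorBasis_adjoint_comp_self]

/-- If `uᵢ` and `wⱼ` are biorthogonal with `⟪wᵢ, uᵢ⟫ = σᵢ > 0`, the orthonormalization `e` of
`u` satisfies `⟪eᵢ, uᵢ⟫ ⟪eᵢ, wᵢ⟫ = σᵢ`, so that the geometric mean of the two factors is `√σᵢ`. -/
theorem exists_orthonormal_sqrt_le {𝕜 E : Type*} [RCLike 𝕜] [NormedAddCommGroup E]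
    [InnerProductSpace 𝕜 E] {r : ℕ} {u w : Fin r → E} {σ : Fin r → ℝ} (hσ : ∀ i, 0 < σ i)
    (h : ∀ i j, inner 𝕜 (w j) (u i) = if i = j then (σ i : 𝕜) else 0) :
    ∃ e : Fin r → E, Orthonormal 𝕜 e ∧ ∀ i,
      2 * √(σ i) ≤ RCLike.re (inner 𝕜 (e i) (u i)) + RCLike.re (inner 𝕜 (e i) (w i)) := by
  have hu : LinearIndependent 𝕜 u :=
    .of_inner_eq_ite (σ := fun i => (σ i : 𝕜)) (fun i => by exact_mod_cast (hσ i).ne') h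
  refine ⟨gramSchmidtNormed 𝕜 u, gramSchmidtNormed_orthonormal hu, fun i => ?_⟩
  set g := gramSchmidt 𝕜 u with hg
  have hl : 0 < ‖g i‖ := norm_pos_iff.2 (gramSchmidt_ne_zero i hu)
  have hsub : u i - g i ∈ Submodule.span 𝕜 (u '' Set.Iio i) := by
    rw [← span_gramSchmidt_Iio, hg]
    nth_rewrite 1 [gramSchmidt_def'' 𝕜 u i]
    rw [add_sub_cancel_left]
    refine Submodule.sum_mem _ fun j hj => Submodule.smul_mem _ _ (Submodule.subset_span ⟨j, ?_, rfl⟩)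
    simpa using hj
  have h1 : inner 𝕜 (g i) (u i - g i) = 0 := by
    rw [← span_gramSchmidt_Iio] at hsub
    refine Submodule.span_induction (p := fun x _ => inner 𝕜 (g i) x = 0) ?_ (by simp) ?_ ?_ hsub
    · rintro _ ⟨j, hj, rfl⟩
      exact gramSchmidt_orthogonal 𝕜 u (ne_of_gt hj)
    · intro x y _ _ hx hy; rw [inner_add_right, hx, hy, add_zero]
    · intro c x _ hx; rw [inner_smul_right, hx, mul_zero]
  -- Biorthogonality makes `w i` orthogonal to every earlier `u j`, so replacing `u i` by `g i`
  -- leaves the pairing `σ i` unchanged.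
  have h2 : inner 𝕜 (w i) (u i - g i) = 0 := by
    refine Submodule.span_induction (p := fun x _ => inner 𝕜 (w i) x = 0) ?_ (by simp) ?_ ?_ hsub
    · rintro _ ⟨j, hj, rfl⟩
      rw [h, if_neg (ne_of_lt hj)]
    · intro x y _ _ hx hy; rw [inner_add_right, hx, hy, add_zero]
    · intro c x _ hx; rw [inner_smul_right, hx, mul_zero]
  rw [inner_sub_right, sub_eq_zero] at h1 h2
  rw [h, if_pos rfl] at h2
  have h3 : RCLike.re (inner 𝕜 (gramSchmidtNormed 𝕜 u i) (u i)) = ‖g i‖ := by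
    rw [gramSchmidtNormed, inner_smul_left, h1, inner_self_eq_norm_sq_to_K]
    have : (starRingEnd 𝕜) ((‖g i‖ : 𝕜)⁻¹) * (‖g i‖ : 𝕜) ^ 2 = ((‖g i‖⁻¹ * ‖g i‖ ^ 2 : ℝ) : 𝕜) := by
      simp
    rw [this, RCLike.ofReal_re]
    field_simp
  have h4 : RCLike.re (inner 𝕜 (gramSchmidtNormed 𝕜 u i) (w i)) = σ i / ‖g i‖ := by
    rw [gramSchmidtNormed, inner_smul_left, ← inner_conj_symm, ← h2]
    have : (starRingEnd 𝕜) ((‖g i‖ : 𝕜)⁻¹) * (starRingEnd 𝕜) (σ i : 𝕜)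
        = ((‖g i‖⁻¹ * σ i : ℝ) : 𝕜) := by
      simp
    rw [this, RCLike.ofReal_re]
    field_simp
  rw [h3, h4]
  have h5 : √(σ i) ^ 2 = σ i := Real.sq_sqrt (hσ i).le
  rw [← sub_nonneg]
  have : ‖g i‖ + σ i / ‖g i‖ - 2 * √(σ i) = (‖g i‖ - √(σ i)) ^ 2 / ‖g i‖ := by
    rw [← h5, Real.sqrt_sq (Real.sqrt_nonneg _)]
    field_simp
    ring
  rw [this]
  positivity

/-- The sum of the square roots of the singular values of `A ∘ B*` is at most the mean of the
trace norms of `A` and `B`. -/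
theorem two_mul_sum_sqrt_singularValues_comp_adjoint_le (A : G →ₗ[𝕜] F) (B : G →ₗ[𝕜] E)
    {n m : ℕ} (hn : finrank 𝕜 E = n) (hm : finrank 𝕜 G = m) :
    2 * ∑ k ∈ Finset.range n, √((A ∘ₗ adjoint B).singularValues k) ≤
      ∑ k ∈ Finset.range m, A.singularValues k + ∑ k ∈ Finset.range m, B.singularValues k := by
  set T := A ∘ₗ adjoint B with hT
  set r := finrank 𝕜 T.range with hr
  have hrn : r ≤ n := hn ▸ T.finrank_range_le
  have hpos (i : Fin r) : 0 < T.singularValues i :=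
    T.singularValues_pos_iff_lt_finrank_range.2 i.2
  -- Only the first `r = rank T` right singular vectors are kept, so that `σᵢ` can be inverted to
  -- define `aᵢ`.
  set b : Fin r → E := fun i =>
    T.isSymmetric_adjoint_comp_self.eigenvectorBasis hn (Fin.castLE hrn i) with hb
  have hbo : Orthonormal 𝕜 b :=
    (T.isSymmetric_adjoint_comp_self.eigenvectorBasis hn).orthonormal.comp _
      (Fin.castLE_injective hrn)
  set a : Fin r → F := fun i => ((T.singularValues i : 𝕜))⁻¹ • T (b i) with ha
  have hTb (i j : Fin r) : inner 𝕜 (T (b i)) (T (b j)) =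
      if i = j then ((T.singularValues i : 𝕜)) ^ 2 else 0 := by
    rw [hb]
    simp only
    rw [inner_apply_eigenvectorBasis_adjoint_comp_self]
    simp
  have hne (i : Fin r) : (T.singularValues i : 𝕜) ≠ 0 := by exact_mod_cast (hpos i).ne'
  have hao : Orthonormal 𝕜 a := by
    rw [orthonormal_iff_ite]
    intro i j
    rw [ha]
    simp only
    rw [inner_smul_left, inner_smul_right, hTb]
    have := hne i
    by_cases hij : i = j
    · subst hij; simp; field_simp
    · simp [hij]
  have hbi (i j : Fin r) : inner 𝕜 (adjoint B (b j)) (adjoint A (a i)) =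
      if i = j then (T.singularValues i : 𝕜) else 0 := by
    rw [adjoint_inner_right, ← LinearMap.comp_apply, ← hT, ha]
    simp only
    rw [inner_smul_right, hTb]
    have := hne i
    by_cases hij : i = j
    · subst hij; simp; field_simp
    · simp [hij, Ne.symm hij]
  obtain ⟨e, heo, he⟩ := exists_orthonormal_sqrt_le (u := fun i => adjoint A (a i))
    (w := fun i => adjoint B (b i)) (σ := fun i => T.singularValues i) hpos hbi
  have hsum : ∑ k ∈ Finset.range n, √(T.singularValues k) = ∑ i : Fin r, √(T.singularValues i) := by
    rw [← Finset.sum_range fun k => √(T.singularValues k)]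
    refine (Finset.sum_subset (Finset.range_mono hrn) fun k _ hk => ?_).symm
    rw [T.singularValues_eq_zero_iff_le_finrank_range.2 (by simpa using hk), Real.sqrt_zero]
  rw [hsum, Finset.mul_sum]
  calc _ ≤ ∑ i, (RCLike.re (inner 𝕜 (A (e i)) (a i)) + RCLike.re (inner 𝕜 (B (e i)) (b i))) := by
        refine Finset.sum_le_sum fun i _ => ?_
        simpa only [adjoint_inner_right] using he i
    _ ≤ _ := by
        rw [Finset.sum_add_distrib]
        exact add_le_add (A.sum_re_inner_le_sum_singularValues heo hao hm)
          (B.sum_re_inner_le_sum_singularValues heo hbo hm)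

end LinearMap

/-! ### The complex representation and its paired singular values. -/

namespace QuaternionMatrix

open Module

variable {L M N : ℕ}

theorem complexAdjoint_injective :
    Function.Injective (complexAdjoint : Matrix (Fin M) (Fin N) ℍ → _) := by
  intro P Q h
  obtain ⟨h1, h2, -, -⟩ := Matrix.fromBlocks_inj.1 h
  ext i j
  · exact congrArg Complex.re (congrFun (congrFun h1 i) j)
  · exact congrArg Complex.im (congrFun (congrFun h1 i) j)
  · exact congrArg Complex.re (congrFun (congrFun h2 i) j)
  · exact congrArg Complex.im (congrFun (congrFun h2 i) j)

theorem complexAdjoint_conjTranspose (Q : Matrix (Fin M) (Fin N) ℍ) :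
    complexAdjoint Qᴴ = (complexAdjoint Q)ᴴ := by
  rw [complexAdjoint, complexAdjoint, Matrix.fromBlocks_conjTranspose]
  congr 1 <;> ext i j <;> simp [Complex.ext_iff]

theorem re_sum {ι : Type*} (s : Finset ι) (f : ι → ℍ) : (∑ i ∈ s, f i).re = ∑ i ∈ s, (f i).re :=
  map_sum (⟨⟨fun q : ℍ => q.re, rfl⟩, fun _ _ => rfl⟩ : ℍ →+ ℝ) f s

theorem imI_sum {ι : Type*} (s : Finset ι) (f : ι → ℍ) : (∑ i ∈ s, f i).imI = ∑ i ∈ s, (f i).imI :=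
  map_sum (⟨⟨fun q : ℍ => q.imI, rfl⟩, fun _ _ => rfl⟩ : ℍ →+ ℝ) f s

theorem imJ_sum {ι : Type*} (s : Finset ι) (f : ι → ℍ) : (∑ i ∈ s, f i).imJ = ∑ i ∈ s, (f i).imJ :=
  map_sum (⟨⟨fun q : ℍ => q.imJ, rfl⟩, fun _ _ => rfl⟩ : ℍ →+ ℝ) f s

theorem imK_sum {ι : Type*} (s : Finset ι) (f : ι → ℍ) : (∑ i ∈ s, f i).imK = ∑ i ∈ s, (f i).imK :=
  map_sum (⟨⟨fun q : ℍ => q.imK, rfl⟩, fun _ _ => rfl⟩ : ℍ →+ ℝ) f s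

theorem complexAdjoint_mul (P : Matrix (Fin L) (Fin M) ℍ) (Q : Matrix (Fin M) (Fin N) ℍ) :
    complexAdjoint (P * Q) = complexAdjoint P * complexAdjoint Q := by
  rw [complexAdjoint, complexAdjoint, complexAdjoint, Matrix.fromBlocks_multiply]
  congr 1 <;> ext i j <;>
    simp only [Matrix.map_apply, Matrix.add_apply, Matrix.mul_apply, Complex.ext_iff, Complex.add_re,
      Complex.add_im, Complex.re_sum, Complex.im_sum, re_sum, imI_sum, imJ_sum, imK_sum,
      Complex.neg_re, Complex.neg_im, Complex.mul_re, Complex.mul_im, Quaternion.re_mul,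
      Quaternion.imI_mul, Quaternion.imJ_mul, Quaternion.imK_mul, Complex.star_def, Complex.conj_re,
      Complex.conj_im, ← Finset.sum_add_distrib, ← Finset.sum_neg_distrib] <;>
    constructor <;> refine Finset.sum_congr rfl fun k _ => ?_ <;> ring

theorem complexAdjoint_diagonal_coe (τ : Fin N → ℝ) :
    complexAdjoint (Matrix.diagonal fun i => (τ i : ℍ)) =
      Matrix.diagonal (Sum.elim (fun i => (τ i : ℂ)) (fun i => (τ i : ℂ))) := by
  rw [complexAdjoint, ← Matrix.fromBlocks_diagonal]
  congr 1 <;> ext i j <;> by_cases h : i = j <;>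
    simp [h, Complex.ext_iff]

theorem complexAdjoint_one : complexAdjoint (1 : Matrix (Fin N) (Fin N) ℍ) = 1 := by
  have := complexAdjoint_diagonal_coe (fun _ : Fin N => 1)
  simpa [← Matrix.diagonal_one, Sum.elim_const_const] using this

/-- Over the noncommutative `ℍ`, the passage from left to right inverses is borrowed from complex
matrices. -/
theorem mul_eq_one_comm {A B : Matrix (Fin N) (Fin N) ℍ} : A * B = 1 ↔ B * A = 1 := by
  rw [← complexAdjoint_injective.eq_iff, ← complexAdjoint_injective.eq_iff (a := B * A)]
  rw [complexAdjoint_mul, complexAdjoint_mul, complexAdjoint_one]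
  exact _root_.mul_eq_one_comm

open Polynomial in
/-- A matrix whose Gram matrix has characteristic polynomial `∏ (X - τᵢ²)`, with `τ` decreasing
and nonnegative, has singular values `τ`. -/
theorem _root_.Matrix.singularValues_toEuclideanLin_eq {m n : Type*} [Fintype m] [Fintype n]
    [DecidableEq n] (A : Matrix m n ℂ) {l : ℕ}
    (hl : Fintype.card n = l) {τ : Fin l → ℝ} (hτ : Antitone τ) (h0 : ∀ i, 0 ≤ τ i)
    (h : (Aᴴ * A).charpoly = ∏ i, (X - C ((τ i : ℂ) ^ 2))) (i : Fin l) :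
    (Matrix.toEuclideanLin A).singularValues i = τ i := by
  classical
  set T := Matrix.toEuclideanLin A with hT
  have hn : finrank ℂ (EuclideanSpace ℂ n) = l := by simpa using hl
  have hc : (LinearMap.adjoint T ∘ₗ T).charpoly = (Aᴴ * A).charpoly := by
    rw [hT, ← Matrix.toEuclideanLin_conjTranspose_eq_adjoint,
      Matrix.toEuclideanLin_eq_toLin_orthonormal, Matrix.toEuclideanLin_eq_toLin_orthonormal,
      ← Matrix.toLin_mul, Matrix.charpoly_toLin]
  have hs := T.isSymmetric_adjoint_comp_self.sort_roots_charpoly_eq_eigenvalues hn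
  have hr : (LinearMap.adjoint T ∘ₗ T).charpoly.roots.map RCLike.re
      = (List.ofFn (fun i => τ i ^ 2) : Multiset ℝ) := by
    rw [hc, h, Polynomial.roots_prod _ _
      (Finset.prod_ne_zero_iff.2 fun i _ => X_sub_C_ne_zero _)]
    simp only [roots_X_sub_C, Multiset.bind_singleton, Multiset.map_map, Function.comp_def]
    rw [← Fin.univ_val_map]
    refine Multiset.map_congr rfl fun i _ => ?_
    rw [← Complex.ofReal_pow]
    exact Complex.ofReal_re _
  have ha : Antitone fun i => τ i ^ 2 := fun i j hij => pow_le_pow_left₀ (h0 j) (hτ hij) 2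
  have : (fun i => τ i ^ 2) = T.isSymmetric_adjoint_comp_self.eigenvalues hn := by
    -- Both lists consist of the same roots in decreasing order.
    apply List.ofFn_injective
    rw [← hs, hr, Multiset.coe_sort]
    refine (List.mergeSort_of_pairwise ?_).symm
    simpa using ha.sortedGE_ofFn.pairwise
  rw [T.singularValues_fin hn, ← this, Real.sqrt_sq (h0 i)]

open Polynomial in
/-- If `B` is unitary and diagonalizes the Gram matrix of `Q`, with eigenvalues `τₖ²` for a
decreasing nonnegative `τ`, then every `τₖ` occurs twice among the singular values of the
equivalent complex matrix. -/
theorem singularValues_complexAdjoint_eq {Q : Matrix (Fin M) (Fin N) ℍ}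
    {B : Matrix (Fin N) (Fin N) ℍ} (hB : Bᴴ * B = 1) {τ : Fin N → ℝ} (hτ : Antitone τ)
    (h0 : ∀ i, 0 ≤ τ i)
    (h : (Q * B)ᴴ * (Q * B) = Matrix.diagonal fun i => ((τ i ^ 2 : ℝ) : ℍ)) (k : Fin N) (j : Fin 2) :
    (Matrix.toEuclideanLin (complexAdjoint Q)).singularValues (j + 2 * k) = τ k := by
  have hB' : complexAdjoint B * (complexAdjoint B)ᴴ = 1 := by
    rw [← complexAdjoint_conjTranspose, ← complexAdjoint_mul, mul_eq_one_comm.1 hB,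
      complexAdjoint_one]
  have hQ : (complexAdjoint B)ᴴ * ((complexAdjoint Q)ᴴ * complexAdjoint Q * complexAdjoint B) =
      Matrix.diagonal (Sum.elim (fun i => ((τ i ^ 2 : ℝ) : ℂ)) (fun i => ((τ i ^ 2 : ℝ) : ℂ))) := by
    rw [← complexAdjoint_diagonal_coe, ← h]
    simp only [complexAdjoint_mul, complexAdjoint_conjTranspose, Matrix.conjTranspose_mul,
      Matrix.mul_assoc]
  -- Positions `2k` and `2k + 1` both carry `τ k`: `finProdFinEquiv` sends `(k, j)` to `j + 2k`, so
  -- the doubled list stays decreasing.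
  have hc : ((complexAdjoint Q)ᴴ * complexAdjoint Q).charpoly =
      ∏ i : Fin (N * 2), (X - C (((τ (finProdFinEquiv.symm i).1 : ℝ) : ℂ) ^ 2)) := by
    have : ((complexAdjoint Q)ᴴ * complexAdjoint Q).charpoly =
      (Matrix.diagonal
        (Sum.elim (fun i => ((τ i ^ 2 : ℝ) : ℂ)) (fun i => ((τ i ^ 2 : ℝ) : ℂ)))).charpoly := by
      rw [← hQ, Matrix.charpoly_mul_comm, Matrix.mul_assoc, hB', Matrix.mul_one]
    rw [this, Matrix.charpoly_diagonal, Fintype.prod_sum_type,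
      finProdFinEquiv.symm.prod_comp fun x : Fin N × Fin 2 => (X - C (((τ x.1 : ℝ) : ℂ) ^ 2)),
      Fintype.prod_prod_type]
    simp only [Sum.elim_inl, Sum.elim_inr, Fin.prod_univ_two, ← Finset.prod_mul_distrib,
      Complex.ofReal_pow]
  have := Matrix.singularValues_toEuclideanLin_eq (complexAdjoint Q) (l := N * 2)
    (by simp; ring) (τ := fun i => τ (finProdFinEquiv.symm i).1) ?_ (fun i => h0 _) hc
    (finProdFinEquiv (k, j))
  · simpa using this
  · intro a b hab
    exact hτ (Nat.div_le_div_right (c := 2) hab)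

theorem singularValue_eq {Q : Matrix (Fin M) (Fin N) ℍ}
    {B : Matrix (Fin N) (Fin N) ℍ} (hB : Bᴴ * B = 1) {τ : Fin N → ℝ} (hτ : Antitone τ)
    (h0 : ∀ i, 0 ≤ τ i)
    (h : (Q * B)ᴴ * (Q * B) = Matrix.diagonal fun i => ((τ i ^ 2 : ℝ) : ℍ)) (k : Fin N) :
    singularValue Q k = τ k := by
  simpa [singularValue] using singularValues_complexAdjoint_eq hB hτ h0 h k 0

theorem singularValue_nonneg (Q : Matrix (Fin M) (Fin N) ℍ) (k : ℕ) : 0 ≤ singularValue Q k :=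
  LinearMap.singularValues_nonneg _ _

theorem singularValue_eq_zero (Q : Matrix (Fin M) (Fin N) ℍ) {k : ℕ} (hk : min M N ≤ k) :
    singularValue Q k = 0 := by
  rw [singularValue, LinearMap.singularValues_eq_zero_iff_le_finrank_range]
  have h1 := (Matrix.toEuclideanLin (complexAdjoint Q)).finrank_range_le
  have h2 := (LinearMap.range (Matrix.toEuclideanLin (complexAdjoint Q))).finrank_le
  simp at h1 h2
  omega

/-- Summing over all columns adds only zeros, and `0 ^ p = 0` since `p > 0`. -/
theorem schatten_eq {p : ℝ} (hp : 0 < p) (Q : Matrix (Fin M) (Fin N) ℍ) :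
    schatten p Q = (∑ k : Fin N, singularValue Q k ^ p) ^ (1 / p) := by
  rw [schatten, ← Finset.sum_range fun k => singularValue Q k ^ p]
  congr 1
  refine Finset.sum_subset (Finset.range_mono (min_le_right _ _)) fun k _ hk => ?_
  rw [singularValue_eq_zero Q (not_lt.1 fun h => hk (Finset.mem_range.2 h)), Real.zero_rpow hp.ne']

theorem nuclearNorm_eq (Q : Matrix (Fin M) (Fin N) ℍ) :
    nuclearNorm Q = ∑ k : Fin N, singularValue Q k := by
  simp [nuclearNorm, schatten_eq]

end QuaternionMatrix

/-! ### The quaternionic spectral theorem. -/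

/-- A symmetric operator commuting with an antiunitary `J` such that `J² = -1` has orthonormal
families of eigenvectors of the form `vᵢ, J vᵢ`. -/
theorem LinearMap.IsSymmetric.exists_orthonormal_eigenvectors_of_antiunitary {E : Type*}
    [NormedAddCommGroup E] [InnerProductSpace ℂ E] [FiniteDimensional ℂ E] {T : E →ₗ[ℂ] E}
    (hT : T.IsSymmetric) {J : E → E} (hJ : ∀ x y, inner ℂ (J x) (J y) = inner ℂ y x)
    (hJJ : ∀ x, J (J x) = -x) (hJs : ∀ (r : ℝ) x, J ((r : ℂ) • x) = (r : ℂ) • J x)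
    (hTJ : ∀ x, T (J x) = J (T x)) (n : ℕ) (hn : 2 * n ≤ Module.finrank ℂ E) :
    ∃ (v : Fin n → E) (μ : Fin n → ℝ), (∀ i, T (v i) = (μ i : ℂ) • v i) ∧
      (∀ i j, inner ℂ (v i) (v j) = if i = j then 1 else 0) ∧
      ∀ i j, inner ℂ (v i) (J (v j)) = 0 := by
  induction n with
  | zero => exact ⟨Fin.elim0, Fin.elim0, fun i => i.elim0, fun i => i.elim0, fun i => i.elim0⟩
  | succ n ih =>
    obtain ⟨v, μ, hv, hvv, hvJ⟩ := ih (by omega)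
    set S := Submodule.span ℂ (Set.range (Sum.elim v (J ∘ v))) with hS
    have hmem (w : E) : w ∈ Sᗮ ↔ ∀ i, inner ℂ (v i) w = 0 ∧ inner ℂ (J (v i)) w = 0 := by
      rw [Submodule.mem_orthogonal]
      constructor
      · exact fun h i => ⟨h _ (Submodule.subset_span ⟨.inl i, rfl⟩),
          h _ (Submodule.subset_span ⟨.inr i, rfl⟩)⟩
      · intro h u hu
        refine Submodule.span_induction (p := fun x _ => inner ℂ x w = 0) ?_ (by simp) ?_ ?_ hu
        · rintro _ ⟨i | i, rfl⟩
          exacts [(h i).1, (h i).2]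
        · intro x y _ _ hx hy; rw [inner_add_left, hx, hy, add_zero]
        · intro c x _ hx; rw [inner_smul_left, hx, mul_zero]
    -- `S` is spanned by eigenvectors, as `J` preserves eigenspaces with real eigenvalue. Its
    -- complement is thus invariant, and supplies the next eigenvector.
    have hinv : ∀ w ∈ Sᗮ, T w ∈ Sᗮ := by
      intro w hw
      rw [hmem] at hw ⊢
      intro i
      rw [← hT, ← hT, hTJ, hv, hJs, inner_smul_left, inner_smul_left, (hw i).1, (hw i).2]
      simp
    have hlt : Module.finrank ℂ S < Module.finrank ℂ E := by
      have : Module.finrank ℂ S ≤ Fintype.card (Fin n ⊕ Fin n) := finrank_range_le_card _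
      simp at this
      omega
    have hne : Sᗮ ≠ ⊥ := by
      rw [Ne, Submodule.orthogonal_eq_bot_iff]
      rintro h
      rw [h, finrank_top] at hlt
      exact hlt.false
    have hTr := hT.restrict_invariant hinv
    obtain ⟨c, hc⟩ : ∃ c, Module.End.HasEigenvalue (T.restrict hinv) c := by
      by_contra hno
      push Not at hno
      have := hTr.subsingleton_of_no_eigenvalue_finiteDimensional
        fun c => by simpa [Module.End.HasEigenvalue, Module.End.HasUnifEigenvalue] using hno c
      exact hne (Submodule.subsingleton_iff_eq_bot.1 this)
    have hcr : (c.re : ℂ) = c := Complex.conj_eq_iff_re.1 (hTr.conj_eigenvalue_eq_self hc)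
    obtain ⟨⟨x, hxS⟩, hx⟩ := hc.exists_hasEigenvector
    have hx0 : x ≠ 0 := fun h => hx.2 (Subtype.ext h)
    have hTx : T x = (c.re : ℂ) • x := by
      rw [hcr]; exact congrArg Subtype.val hx.apply_eq_smul
    set w : E := ((‖x‖⁻¹ : ℝ) : ℂ) • x with hw
    have hwS : w ∈ Sᗮ := Submodule.smul_mem _ _ hxS
    have hww : inner ℂ w w = 1 := by
      have h1 : ‖w‖ = 1 := by
        rw [hw, norm_smul, Complex.norm_real, Real.norm_of_nonneg (by positivity),
          inv_mul_cancel₀ (norm_ne_zero_iff.2 hx0)]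
      rw [inner_self_eq_norm_sq_to_K, h1]; simp
    have hTw : T w = (c.re : ℂ) • w := by rw [hw, map_smul, hTx, smul_comm]
    -- Antiunitarity and `J² = -1` give `⟪w, J w⟫ = -⟪w, J w⟫`.
    have hwJ : inner ℂ w (J w) = 0 := by
      have := hJ (J w) w
      rw [hJJ, inner_neg_left] at this
      exact self_eq_neg.1 this.symm
    have hsymm (x y : E) : inner ℂ x (J y) = - inner ℂ y (J x) := by
      rw [← hJ, hJJ, inner_neg_left]
    rw [hmem] at hwS
    refine ⟨Fin.cons w v, Fin.cons c.re μ, ?_, ?_, ?_⟩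
    · refine Fin.cases hTw fun i => ?_
      simpa using hv i
    · refine Fin.cases (Fin.cases (by simpa using hww) fun j => ?_)
        fun i => Fin.cases ?_ fun j => ?_
      · simpa [(Fin.succ_ne_zero _).symm] using inner_eq_zero_symm.1 (hwS j).1
      · simpa [Fin.succ_ne_zero] using (hwS i).1
      · simpa using hvv i j
    · refine Fin.cases (Fin.cases (by simpa using hwJ) fun j => ?_)
        fun i => Fin.cases ?_ fun j => ?_
      · simpa using inner_eq_zero_symm.1 (hwS j).2
      · simp only [Fin.cons_succ, Fin.cons_zero]
        rw [hsymm, inner_eq_zero_symm.1 (hwS i).2, neg_zero]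
      · simpa using hvJ i j

namespace QuaternionMatrix

variable {M N : ℕ}

/-- Right multiplication by the unit `j`, written in the complex coordinates in which the first
column of `complexAdjoint` represents a quaternion column. -/
noncomputable def rightMulJ (x : EuclideanSpace ℂ (Fin N ⊕ Fin N)) :
    EuclideanSpace ℂ (Fin N ⊕ Fin N) :=
  WithLp.toLp 2 (Sum.elim (fun i => -star (x (.inr i))) (fun i => star (x (.inl i))))

theorem inner_rightMulJ (x y : EuclideanSpace ℂ (Fin N ⊕ Fin N)) :
    inner ℂ (rightMulJ x) (rightMulJ y) = inner ℂ y x := by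
  simp [rightMulJ, PiLp.inner_apply, Fintype.sum_sum_type, mul_comm, add_comm]

theorem rightMulJ_rightMulJ (x : EuclideanSpace ℂ (Fin N ⊕ Fin N)) :
    rightMulJ (rightMulJ x) = -x := by
  ext (i | i) <;> simp [rightMulJ]

theorem rightMulJ_ofReal_smul (r : ℝ) (x : EuclideanSpace ℂ (Fin N ⊕ Fin N)) :
    rightMulJ ((r : ℂ) • x) = (r : ℂ) • rightMulJ x := by
  ext (i | i) <;> simp [rightMulJ]

/-- Left multiplication by a matrix commutes with right multiplication by a scalar. -/
theorem toEuclideanLin_complexAdjoint_rightMulJ (Q : Matrix (Fin N) (Fin N) ℍ)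
    (x : EuclideanSpace ℂ (Fin N ⊕ Fin N)) :
    Matrix.toEuclideanLin (complexAdjoint Q) (rightMulJ x) =
      rightMulJ (Matrix.toEuclideanLin (complexAdjoint Q) x) := by
  ext (i | i) <;>
    simp [rightMulJ, complexAdjoint, Matrix.mulVec, dotProduct, Fintype.sum_sum_type, add_comm]

/-- The quaternion matrix whose equivalent complex matrix has the columns `vₖ` and `vₖ j`. -/
def ofComplexColumns (v : Fin M → EuclideanSpace ℂ (Fin N ⊕ Fin N)) : Matrix (Fin N) (Fin M) ℍ :=
  fun i k => ⟨(v k (.inl i)).re, (v k (.inl i)).im, -(v k (.inr i)).re, (v k (.inr i)).im⟩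

theorem complexAdjoint_ofComplexColumns (v : Fin M → EuclideanSpace ℂ (Fin N ⊕ Fin N)) :
    complexAdjoint (ofComplexColumns v) =
      Matrix.of fun a b => Sum.elim v (fun k => rightMulJ (v k)) b a := by
  ext (i | i) (k | k) <;>
    simp [complexAdjoint, ofComplexColumns, rightMulJ, Complex.ext_iff]

open scoped ComplexOrder in
/-- The spectral theorem for the Gram matrix of a quaternion matrix. -/
theorem exists_unitary_diagonal (Q : Matrix (Fin M) (Fin N) ℍ) :
    ∃ (B : Matrix (Fin N) (Fin N) ℍ) (τ : Fin N → ℝ), Bᴴ * B = 1 ∧ Antitone τ ∧ (∀ i, 0 ≤ τ i) ∧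
      (Q * B)ᴴ * (Q * B) = Matrix.diagonal fun i => ((τ i ^ 2 : ℝ) : ℍ) := by
  have hpos : (complexAdjoint (Qᴴ * Q)).PosSemidef := by
    rw [complexAdjoint_mul, complexAdjoint_conjTranspose]
    exact Matrix.posSemidef_conjTranspose_mul_self _
  obtain ⟨v, μ, hv, hvv, hvJ⟩ :=
    (Matrix.isPositive_toEuclideanLin_iff.2 hpos).isSymmetric.exists_orthonormal_eigenvectors_of_antiunitary
      inner_rightMulJ rightMulJ_rightMulJ rightMulJ_ofReal_smul
      (toEuclideanLin_complexAdjoint_rightMulJ _) N (by simp; omega)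
  have hμ (i : Fin N) : 0 ≤ μ i := by
    have := (Matrix.isPositive_toEuclideanLin_iff.2 hpos).re_inner_nonneg_right (v i)
    rw [hv, inner_smul_right, hvv] at this
    simpa using this
  set s := Tuple.sort fun i => -μ i
  -- Sorting `-μ` increasingly lists the eigenvalues in decreasing order.
  have hs : Antitone (μ ∘ s) := fun i j hij =>
    neg_le_neg_iff.1 (Tuple.monotone_sort (fun i => -μ i) hij)
  have hBc := complexAdjoint_ofComplexColumns (v ∘ s)
  set B := ofComplexColumns (v ∘ s) with hB
  have h1 : Bᴴ * B = 1 := by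
    apply complexAdjoint_injective
    rw [complexAdjoint_mul, complexAdjoint_conjTranspose, complexAdjoint_one, hBc]
    have key (a b : Fin N ⊕ Fin N) : ((Matrix.of fun a b =>
        Sum.elim (v ∘ s) (fun k => rightMulJ ((v ∘ s) k)) b a)ᴴ * (Matrix.of fun a b =>
        Sum.elim (v ∘ s) (fun k => rightMulJ ((v ∘ s) k)) b a)) a b =
        inner ℂ (Sum.elim (v ∘ s) (fun k => rightMulJ ((v ∘ s) k)) a)
          (Sum.elim (v ∘ s) (fun k => rightMulJ ((v ∘ s) k)) b) := by
      simp [Matrix.mul_apply, PiLp.inner_apply, mul_comm]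
    ext (a | a) (b | b)
    all_goals rw [key]
    · simp [hvv, Matrix.one_apply]
    · simp [hvJ]
    · simpa using inner_eq_zero_symm.1 (hvJ (s b) (s a))
    · simp [inner_rightMulJ, hvv, Matrix.one_apply, eq_comm]
  refine ⟨B, fun i => √(μ (s i)), h1, fun i j hij => Real.sqrt_le_sqrt (hs hij),
    fun i => Real.sqrt_nonneg _, ?_⟩
  have h2 : Qᴴ * Q * B = B * Matrix.diagonal fun i => (μ (s i) : ℍ) := by
    apply complexAdjoint_injective
    rw [complexAdjoint_mul _ B, complexAdjoint_mul B, complexAdjoint_diagonal_coe, hBc]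
    have key (b : Fin N ⊕ Fin N) :
        Matrix.toEuclideanLin (complexAdjoint (Qᴴ * Q))
          (Sum.elim (v ∘ s) (fun k => rightMulJ ((v ∘ s) k)) b) =
        Sum.elim (fun i => (μ (s i) : ℂ)) (fun i => (μ (s i) : ℂ)) b •
          Sum.elim (v ∘ s) (fun k => rightMulJ ((v ∘ s) k)) b := by
      rcases b with b | b
      · simpa using hv (s b)
      · simp only [Sum.elim_inr, Function.comp_apply]
        rw [toEuclideanLin_complexAdjoint_rightMulJ, hv, rightMulJ_ofReal_smul]
    ext a b
    rw [Matrix.mul_diagonal, mul_comm]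
    exact congrArg (fun x : EuclideanSpace ℂ (Fin N ⊕ Fin N) => x a) (key b)
  rw [Matrix.conjTranspose_mul, Matrix.mul_assoc, ← Matrix.mul_assoc Qᴴ, h2, ← Matrix.mul_assoc,
    h1, Matrix.one_mul]
  simp only [Real.sq_sqrt (hμ _)]

end QuaternionMatrix

/-! ### The lower bound, the role of the rank, and an optimal factorization. -/

namespace QuaternionMatrix

variable {M N d : ℕ}

/-- Converts complex sums to quaternionic ones; used with `f = id` for nuclear norms and `f = √` for
the product. -/
theorem sum_singularValues_complexAdjoint (Q : Matrix (Fin M) (Fin N) ℍ) (f : ℝ → ℝ) :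
    ∑ k ∈ Finset.range (N * 2), f ((Matrix.toEuclideanLin (complexAdjoint Q)).singularValues k) =
      2 * ∑ k : Fin N, f (singularValue Q k) := by
  obtain ⟨B, τ, hB, hτ, h0, h⟩ := exists_unitary_diagonal Q
  rw [Finset.sum_range, ← finProdFinEquiv.sum_comp, Fintype.sum_prod_type, Finset.mul_sum]
  refine Finset.sum_congr rfl fun k _ => ?_
  simp only [finProdFinEquiv_apply_val, singularValues_complexAdjoint_eq hB hτ h0 h,
    singularValue_eq hB hτ h0 h]
  simp

theorem schatten_half_eq (Q : Matrix (Fin M) (Fin N) ℍ) :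
    schatten (1 / 2) Q = (∑ k : Fin N, √(singularValue Q k)) ^ 2 := by
  rw [schatten_eq (by norm_num)]
  simp only [Real.sqrt_eq_rpow, one_div, inv_inv]
  exact_mod_cast Real.rpow_natCast _ 2

theorem sum_sqrt_singularValue_mul_conjTranspose_le (U : Matrix (Fin M) (Fin d) ℍ)
    (V : Matrix (Fin N) (Fin d) ℍ) :
    ∑ k : Fin N, √(singularValue (U * Vᴴ) k) ≤ 1 / 2 * (nuclearNorm U + nuclearNorm V) := by
  have h := LinearMap.two_mul_sum_sqrt_singularValues_comp_adjoint_le (n := N * 2) (m := d * 2)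
    (Matrix.toEuclideanLin (complexAdjoint U)) (Matrix.toEuclideanLin (complexAdjoint V))
    (by simp; ring) (by simp; ring)
  have hT : Matrix.toEuclideanLin (complexAdjoint U) ∘ₗ
      LinearMap.adjoint (Matrix.toEuclideanLin (complexAdjoint V)) =
      Matrix.toEuclideanLin (complexAdjoint (U * Vᴴ)) := by
    rw [← Matrix.toEuclideanLin_conjTranspose_eq_adjoint, complexAdjoint_mul,
      complexAdjoint_conjTranspose]
    simp only [Matrix.toEuclideanLin_eq_toLin_orthonormal]
    rw [← Matrix.toLin_mul]
  have hU := sum_singularValues_complexAdjoint U id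
  have hV := sum_singularValues_complexAdjoint V id
  simp only [id] at hU hV
  rw [hT, sum_singularValues_complexAdjoint _ Real.sqrt, hU, hV] at h
  rw [nuclearNorm_eq, nuclearNorm_eq]
  linarith

theorem apply_eq_zero_of_gram_eq_zero {A : Matrix (Fin M) (Fin N) ℍ} {k : Fin N}
    (h : (Aᴴ * A) k k = 0) (i : Fin M) : A i k = 0 := by
  simp only [Matrix.mul_apply, Matrix.conjTranspose_apply, Quaternion.star_mul_self] at h
  have h' : ∑ x, Quaternion.normSq (A x k) = 0 := by
    have := congrArg QuaternionAlgebra.re h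
    rw [re_sum] at this
    simpa using this
  exact Quaternion.normSq_eq_zero.1 ((Finset.sum_eq_zero_iff_of_nonneg
    fun x _ => Quaternion.normSq_nonneg).1 h' i (Finset.mem_univ i))

/-- The number of nonzero diagonal entries in a diagonalization of the Gram matrix of `X` is at most
the rank of `X`. -/
theorem card_ne_zero_le_rank {X : Matrix (Fin M) (Fin N) ℍ} {B : Matrix (Fin N) (Fin N) ℍ}
    {τ : Fin N → ℝ}
    (h : (X * B)ᴴ * (X * B) = Matrix.diagonal fun i => ((τ i ^ 2 : ℝ) : ℍ)) :
    Fintype.card {i // τ i ≠ 0} ≤ rank X := by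
  have hind : LinearIndependent ℍᵐᵒᵖ fun i : {i // τ i ≠ 0} => (X * B).col i := by
    rw [Fintype.linearIndependent_iff]
    intro c hc l
    -- Pairing the relation on the left with column `l` leaves only `τ l ^ 2` times the `l`-th
    -- coefficient; the scalars stay on the right.
    have h1 : ∑ i : {i // τ i ≠ 0}, ((X * B)ᴴ * (X * B)) l i * (c i).unop = 0 := by
      have h2 (x : Fin M) : ∑ i : {i // τ i ≠ 0}, (X * B) x i * (c i).unop = 0 := by
        have := congrFun hc x
        rw [Finset.sum_apply] at this
        exact this
      simp only [Matrix.mul_apply (M := (X * B)ᴴ), Finset.sum_mul]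
      rw [Finset.sum_comm]
      simp only [mul_assoc, ← Finset.mul_sum, h2, mul_zero, Finset.sum_const_zero]
    rw [h, Finset.sum_eq_single l (fun i _ hi => by
      rw [Matrix.diagonal_apply_ne _ (fun hh => hi (Subtype.ext hh.symm)), zero_mul])
      (fun hl => (hl (Finset.mem_univ l)).elim), Matrix.diagonal_apply_eq] at h1
    rcases mul_eq_zero.1 h1 with h1 | h1
    · have : τ l ^ 2 = 0 := Quaternion.coe_injective (h1.trans Quaternion.coe_zero.symm)
      exact (l.2 (pow_eq_zero_iff two_ne_zero |>.1 this)).elim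
    · exact MulOpposite.unop_injective h1
  rw [← finrank_span_eq_card hind, rank]
  have := FiniteDimensional.span_of_finite ℍᵐᵒᵖ (Set.finite_range X.col)
  refine Submodule.finrank_mono (Submodule.span_le.2 ?_)
  rintro _ ⟨i, rfl⟩
  have : (X * B).col i = ∑ j, MulOpposite.op (B j i) • X.col j := by
    ext1 x
    rw [Finset.sum_apply]
    rfl
  simp only [SetLike.mem_coe]
  rw [this]
  exact Submodule.sum_mem _ fun j _ => Submodule.smul_mem _ _ (Submodule.subset_span ⟨j, rfl⟩)

/-- The `N × d` matrix with the real entries `a` on its main diagonal. -/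
noncomputable def rectDiagonal (N d : ℕ) (a : ℕ → ℝ) : Matrix (Fin N) (Fin d) ℍ :=
  fun i k => if (i : ℕ) = k then ((a i : ℝ) : ℍ) else 0

theorem rectDiagonal_mul_conjTranspose (a b : ℕ → ℝ) :
    rectDiagonal N d a * (rectDiagonal N d b)ᴴ =
      Matrix.diagonal fun i : Fin N => if (i : ℕ) < d then ((a i * b i : ℝ) : ℍ) else 0 := by
  ext1 i j
  rw [Matrix.mul_apply]
  simp only [rectDiagonal, Matrix.conjTranspose_apply, ite_mul, zero_mul]
  by_cases hi : (i : ℕ) < d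
  · rw [Finset.sum_eq_single ⟨i, hi⟩ (fun k _ hk => if_neg fun h => hk (Fin.ext h.symm)) (by simp)]
    by_cases hij : i = j
    · subst hij; simp [hi]
    · simp [hij, Fin.val_inj, Ne.symm hij]
  · rw [Finset.sum_eq_zero fun k _ => if_neg (by omega)]
    by_cases hij : i = j
    · subst hij; simp [hi]
    · simp [hij]

theorem conjTranspose_rectDiagonal_mul_diagonal_mul (a : ℕ → ℝ) (t : ℕ → ℝ) :
    (rectDiagonal N d a)ᴴ * ((Matrix.diagonal fun i : Fin N => ((t i : ℝ) : ℍ)) *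
      rectDiagonal N d a) =
      Matrix.diagonal fun k : Fin d => if (k : ℕ) < N then ((a k ^ 2 * t k : ℝ) : ℍ) else 0 := by
  ext1 k l
  rw [Matrix.mul_apply]
  simp only [rectDiagonal, Matrix.conjTranspose_apply, Matrix.diagonal_mul]
  by_cases hk : (k : ℕ) < N
  · rw [Finset.sum_eq_single ⟨k, hk⟩
      (fun i _ hi => by rw [if_neg fun h => hi (Fin.ext h), star_zero, zero_mul]) (by simp)]
    by_cases hkl : k = l
    · subst hkl
      simp only [if_true, Matrix.diagonal_apply_eq, if_pos hk, Quaternion.star_coe]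
      norm_cast
      ring_nf
    · simp [hkl, Fin.val_inj]
  · rw [Finset.sum_eq_zero fun i _ => by
      rw [if_neg (by omega), star_zero, zero_mul]]
    by_cases hkl : k = l
    · subst hkl; simp [hk]
    · simp [hkl]

/-- A matrix with Gram matrix `diag(σ₀, σ₁, …)` has nuclear norm `∑ √σₖ`. -/
theorem nuclearNorm_eq_of_gram_eq {U : Matrix (Fin M) (Fin d) ℍ} {σ : ℕ → ℝ} (hσ : Antitone σ)
    (h0 : ∀ k, 0 ≤ σ k) (h : Uᴴ * U = Matrix.diagonal fun k : Fin d => ((σ k : ℝ) : ℍ)) :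
    nuclearNorm U = ∑ k ∈ Finset.range d, √(σ k) := by
  rw [nuclearNorm_eq, Finset.sum_range]
  refine Finset.sum_congr rfl fun k _ => ?_
  refine singularValue_eq (B := 1) (τ := fun k : Fin d => √(σ k)) (by simp)
    (fun i j hij => Real.sqrt_le_sqrt (hσ hij)) (fun i => Real.sqrt_nonneg _) ?_ k
  simp only [Matrix.mul_one, h, Real.sq_sqrt (h0 _)]

/-- An optimal factorization: half powers of the singular values are attached to the left and to
the right singular vectors. -/
theorem exists_factorization (X : Matrix (Fin M) (Fin N) ℍ) (hX : rank X ≤ d) :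
    ∃ (U : Matrix (Fin M) (Fin d) ℍ) (V : Matrix (Fin N) (Fin d) ℍ), X = U * Vᴴ ∧
      nuclearNorm U = ∑ k : Fin N, √(singularValue X k) ∧
      nuclearNorm V = ∑ k : Fin N, √(singularValue X k) := by
  obtain ⟨B, τ, hB, hτ, h0, h⟩ := exists_unitary_diagonal X
  set σ : ℕ → ℝ := singularValue X with hσ
  have hστ (k : Fin N) : σ k = τ k := singularValue_eq hB hτ h0 h k
  have hσN {k : ℕ} (hk : N ≤ k) : σ k = 0 := singularValue_eq_zero X (min_le_right M N |>.trans hk)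
  have hσ0 (k : ℕ) : 0 ≤ σ k := singularValue_nonneg X k
  have hanti : Antitone σ := fun i j hij =>
    LinearMap.singularValues_antitone _ (Nat.mul_le_mul_left 2 hij)
  have hσd {k : ℕ} (hk : d ≤ k) : σ k = 0 := by
    by_contra hne
    have hkN : k < N := by
      by_contra hk'
      exact hne (hσN (not_lt.1 hk'))
    have hpos : 0 < σ k := lt_of_le_of_ne (hσ0 k) (Ne.symm hne)
    -- If `σ k ≠ 0` with `k ≥ d`, then `τ 0, …, τ k` are `k + 1 > d` nonzero values, against the
    -- rank bound.
    let f : Fin (k + 1) → {i // τ i ≠ 0} := fun i =>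
      ⟨⟨i, (Nat.lt_succ_iff.1 i.2).trans_lt hkN⟩, by
        rw [← hστ]; exact (hpos.trans_le (hanti (Nat.lt_succ_iff.1 i.2))).ne'⟩
    have hf : Function.Injective f := fun i j hij => Fin.ext (by simpa [f] using hij)
    have := Fintype.card_le_of_injective f hf
    have := card_ne_zero_le_rank h
    rw [Fintype.card_fin] at *
    omega
  have hgram : (X * B)ᴴ * (X * B) = Matrix.diagonal fun i : Fin N => ((σ i ^ 2 : ℝ) : ℍ) := by
    simp only [h, hστ]
  have hsum : ∑ k ∈ Finset.range d, √(σ k) = ∑ k : Fin N, √(σ k) := by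
    rw [← Finset.sum_range fun k => √(σ k)]
    rcases le_total d N with hdN | hdN
    · exact Finset.sum_subset (Finset.range_mono hdN) fun k _ hk => by
        rw [hσd (not_lt.1 fun h => hk (Finset.mem_range.2 h)), Real.sqrt_zero]
    · exact (Finset.sum_subset (Finset.range_mono hdN) fun k _ hk => by
        rw [hσN (not_lt.1 fun h => hk (Finset.mem_range.2 h)), Real.sqrt_zero]).symm
  -- As `X B = A D`, the factor `A D^{1/2}` is `X B D^{-1/2}`, so `A` need not be constructed. The
  -- convention `0⁻¹ = 0` covers vanishing singular values.
  refine ⟨X * B * rectDiagonal N d fun k => (√(σ k))⁻¹, B * rectDiagonal N d fun k => √(σ k),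
    ?_, ?_, ?_⟩
  -- The diagonal factor is the projection onto the indices with `σ i ≠ 0`; the other columns of `X
  -- * B` vanish because their Gram entries do.
  · have hD : X * B * (Matrix.diagonal fun i : Fin N =>
        if (i : ℕ) < d then (((√(σ i))⁻¹ * √(σ i) : ℝ) : ℍ) else 0) = X * B := by
      ext1 x k
      rw [Matrix.mul_diagonal]
      rcases (hσ0 k).eq_or_lt with hk | hk
      · rw [apply_eq_zero_of_gram_eq_zero (A := X * B) (k := k) (by rw [hgram]; simp [← hk]), zero_mul]
      · rw [if_pos (not_le.1 fun hdk => hk.ne' (hσd hdk)),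
          inv_mul_cancel₀ (Real.sqrt_pos.2 hk).ne']
        simp
    rw [Matrix.conjTranspose_mul, Matrix.mul_assoc, ← Matrix.mul_assoc (rectDiagonal N d _),
      rectDiagonal_mul_conjTranspose, ← Matrix.mul_assoc, hD, Matrix.mul_assoc,
      mul_eq_one_comm.1 hB, Matrix.mul_one]
  · rw [← hsum]
    refine nuclearNorm_eq_of_gram_eq hanti hσ0 ?_
    rw [Matrix.conjTranspose_mul, Matrix.mul_assoc, ← Matrix.mul_assoc (X * B)ᴴ, hgram,
      conjTranspose_rectDiagonal_mul_diagonal_mul (fun k => (√(σ k))⁻¹) fun k => σ k ^ 2]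
    congr 1
    ext1 k
    split_ifs with hk
    · congr 1
      rw [inv_pow, Real.sq_sqrt (hσ0 k)]
      rcases (hσ0 k).eq_or_lt with hk | hk
      · simp [← hk]
      · field_simp
    · rw [hσN (not_lt.1 hk), Quaternion.coe_zero]
  · rw [← hsum]
    refine nuclearNorm_eq_of_gram_eq hanti hσ0 ?_
    have := conjTranspose_rectDiagonal_mul_diagonal_mul (N := N) (d := d)
      (fun k => √(σ k)) fun _ => 1
    simp only [Quaternion.coe_one, Matrix.diagonal_one, Matrix.one_mul] at this
    rw [Matrix.conjTranspose_mul, Matrix.mul_assoc, ← Matrix.mul_assoc Bᴴ, hB, Matrix.one_mul, this]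
    congr 1
    ext1 k
    split_ifs with hk
    · rw [mul_one, Real.sq_sqrt (hσ0 k)]
    · rw [hσN (not_lt.1 hk), Quaternion.coe_zero]

theorem isLeast_doubleNuclearValues (X : Matrix (Fin M) (Fin N) ℍ) (hX : rank X ≤ d) :
    IsLeast (doubleNuclearValues d X) (schatten (1 / 2) X) := by
  rw [schatten_half_eq]
  constructor
  · obtain ⟨U, V, h, hU, hV⟩ := exists_factorization X hX
    refine ⟨U, V, h, ?_⟩
    rw [hU, hV]
    ring
  · rintro _ ⟨U, V, rfl, rfl⟩
    calc _ ≤ (1 / 2 * (nuclearNorm U + nuclearNorm V)) ^ 2 :=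
          pow_le_pow_left₀ (Finset.sum_nonneg fun _ _ => Real.sqrt_nonneg _)
            (sum_sqrt_singularValue_mul_conjTranspose_le U V) 2
      _ = _ := by ring

end QuaternionMatrix

theorem theorem4 {M N d : ℕ} (X : Matrix (Fin M) (Fin N) ℍ)
    (hX : QuaternionMatrix.rank X ≤ d) :
    IsLeast (QuaternionMatrix.doubleNuclearValues d X)
        (QuaternionMatrix.doubleNuclearNorm d X) ∧
      QuaternionMatrix.doubleNuclearNorm d X = QuaternionMatrix.schatten (1 / 2) X := by
  have h := QuaternionMatrix.isLeast_doubleNuclearValues X hX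
  have heq : QuaternionMatrix.doubleNuclearNorm d X = QuaternionMatrix.schatten (1 / 2) X :=
    h.csInf_eq
  exact ⟨heq ▸ h, heq⟩
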